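/- Fix integers $N,n,r,m\ge 0$ with $r+m\le n<N$ and a generalized BB84 protocol: a probability distribution $\Pr(\mathbf b,\mathbf s)$ on pairs $\mathbf b,\mathbf s\in\mathbf F_2^N$ with $|\mathbf s|=n$, and a testing function $T:\mathbf F_2^{N-n}\times\mathbf F_2^{N-n}\times\mathbf F_2^N\to\{0,1\}$. For $\mathbf x\in\mathbf F_2^N$ let $\mathbf x_{\mathrm I}$ and $\mathbf x_{\mathrm T}$ be the substrings at the positions with $s_j=1$ and $s_j=0$. Alice chooses $\mathbf i\in\mathbf F_2^N$ uniformly, $(\mathbf b,\mathbf s)$ according to $\Pr(\mathbf b,\mathbf s)$, and, uniformly, an $r\times n$ matrix $P_{\mathrm C}$ and an $m\times n$ matrix $P_{\mathrm K}$ over $\mathbf F_2$ whose $r+m$ rows together are linearly independent (the choices of $\mathbf i$, of $(\mathbf b,\mathbf s)$ and of $(P_{\mathrm C},P_{\mathrm K})$ being independent). She sends $|\mathbf i\rangle_{\mathbf b}=\bigotimes_l|i_l\rangle_{b_l}$, where $|0\rangle_0,|1\rangle_0$ is the computational and $|0\rangle_1,|1\rangle_1$ the Hadamard basis; Bob measures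 in the basis $\mathbf b$ and gets $\mathbf j$. A joint attack consists of a Hilbert space $\mathrm E$, a unit vector $|0\rangle_{\mathrm E}$ and a unitary $U$ on $\mathrm E$ together with the $N$ qubits. Write $U|0\rangle_{\mathrm E}|\mathbf i\rangle_{\mathbf b}=\sum_{\mathbf j}|E'_{\mathbf i,\mathbf j}\rangle_{\mathbf b}|\mathbf j\rangle_{\mathbf b}$; then $\Pr(\mathbf j\mid\mathbf i,\mathbf b,\mathbf s)=\langle E'_{\mathbf i,\mathbf j}|E'_{\mathbf i,\mathbf j}\rangle_{\mathbf b}$, and $\rho_{\mathbf i,\mathbf j}^{\mathbf b}=|E'_{\mathbf i,\mathbf j}\rangle_{\mathbf b}\langle E'_{\mathbf i,\mathbf j}|_{\mathbf b}/\Pr(\mathbf j\mid\mathbf i,\mathbf b,\mathbf s)$ is Eve's normalized state. With $\mathbf k=\mathbf i_{\mathrm I}P_{\mathrm K}^{T}$ and $\boldsymbol\xi=\mathbf i_{\mathrm I}P_{\mathrm C}^{T}$ put $$\sigma_{\mathrm{ABE}}=\sum_{\substack{\mathbf i,\mathbf j,\mathbf b,\mathbf s,P_{\mathrm C},P_{\mathrm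 K}\\ T(\mathbf i_{\mathrm T}\oplus\mathbf j_{\mathrm T},\mathbf b_{\mathrm T},\mathbf s)=1}}\Pr(\mathbf i,\mathbf j,\mathbf b,\mathbf s,P_{\mathrm C},P_{\mathrm K})\,|\mathbf k\rangle\langle\mathbf k|_{\mathrm A}\otimes|\mathbf k\rangle\langle\mathbf k|_{\mathrm B}\otimes\rho_{\mathbf i,\mathbf j}^{\mathbf b}\otimes|\mathbf c\rangle\langle\mathbf c|_{\mathrm C},\qquad \mathbf c=(\mathbf i_{\mathrm T},\mathbf j_{\mathrm T},\mathbf b,\mathbf s,\boldsymbol\xi,P_{\mathrm C},P_{\mathrm K}),$$ $\sigma_{\mathrm E}=\operatorname{tr}_{\mathrm{AB}}\sigma_{\mathrm{ABE}}$ and $\rho_{\mathrm U}=2^{-m}\sum_{\mathbf k\in\mathbf F_2^m}|\mathbf k\rangle\langle\mathbf k|_{\mathrm A}\otimes|\mathbf k\rangle\langle\mathbf k|_{\mathrm B}$. The symmetrized attack has the probe $\mathrm E\otimes\mathrm M$, where $\mathrm M$ has the orthonormal basis $\{|\mathbf m\rangle\}_{\mathbf m\in\mathbf F_2^N}$, the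 initial state $|0\rangle_{\mathrm E}\otimes 2^{-N/2}\sum_{\mathbf m}|\mathbf m\rangle_{\mathrm M}$ and the unitary $U^{\mathrm{sym}}=(\mathbf I_{\mathrm E}\otimes S^\dagger)(U\otimes\mathbf I_{\mathrm M})(\mathbf I_{\mathrm E}\otimes S)$, where $S|\mathbf i\rangle_{\mathbf b}|\mathbf m\rangle_{\mathrm M}=(-1)^{(\mathbf i\oplus\mathbf b)\cdot\mathbf m}|\mathbf i\oplus\mathbf m\rangle_{\mathbf b}|\mathbf m\rangle_{\mathrm M}$ for all $\mathbf b$; the states $\sigma^{\mathrm{sym}}_{\mathrm{ABE}},\sigma^{\mathrm{sym}}_{\mathrm E}$ are those of this attack. Then for every joint attack $$\tfrac12\operatorname{tr}\left|\sigma_{\mathrm{ABE}}-\rho_{\mathrm U}\otimes\sigma_{\mathrm E}\right|\le\tfrac12\operatorname{tr}\left|\sigma^{\mathrm{sym}}_{\mathrm{ABE}}-\rho_{\mathrm U}\otimes\sigma^{\mathrm{sym}}_{\mathrm E}\right|.$$ Consequently, for every $\varepsilon\in[0,\infty]$, if the right-hand side is at most $\varepsilon$ for the symmetrizations of all joint attacks,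 then the left-hand side is at most $\varepsilon$ for all joint attacks. -/

import Mathlib

open scoped ENNReal InnerProductSpace Kronecker ComplexConjugate

noncomputable section

namespace GenBB84

/-! ## Composite systems, partial trace and trace norm -/

/-- The composite system `ℂ^X ⊗ H` of a register with (finite) orthonormal basis `X` and a Hilbert
space `H`, as the Hilbert direct sum of `X` copies of `H`: the vector `Φ` stands for
`∑ x, |x⟩ ⊗ Φ x`. -/
abbrev Reg (X : Type*) (H : Type*) := PiLp 2 (fun _ : X => H)

section Registers

variable {X H : Type*} [Fintype X] [DecidableEq X] [NormedAddCommGroup H] [InnerProductSpace ℂ H]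

/-- The product vector `ψ ⊗ e` in `ℂ^X ⊗ H`. -/
def prodVec (ψ : EuclideanSpace ℂ X) (e : H) : Reg X H :=
  WithLp.toLp 2 fun x => ψ x • e

/-- The isometry `e ↦ |x⟩ ⊗ e`. -/
def inj (x : X) : H →L[ℂ] Reg X H :=
  LinearMap.mkContinuous
    { toFun := fun e => PiLp.single 2 x e
      map_add' := fun a b => PiLp.single_add 2 x
      map_smul' := fun c a => by
        ext y
        by_cases h : y = x
        · subst h; simp
        · simp [h] } 1 (fun e => by simp)

/-- The tensor product `A ⊗ T` of an operator `A` on `ℂ^X`, given by its matrix,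
and an operator `T` on `H`. -/
def tensorOp (A : Matrix X X ℂ) (T : H →L[ℂ] H) : Reg X H →L[ℂ] Reg X H :=
  ∑ x, ∑ y, A x y • (inj x ∘L T ∘L PiLp.proj 2 (fun _ : X => H) y)

/-- The partial trace over the register `ℂ^X` of an operator on `ℂ^X ⊗ H`. -/
def traceOut (T : Reg X H →L[ℂ] Reg X H) : H →L[ℂ] H :=
  ∑ x, PiLp.proj 2 (fun _ : X => H) x ∘L T ∘L inj x

/-- The matrix of the projector `|x⟩⟨x|` on `ℂ^X`. -/
def projector (x : X) : Matrix X X ℂ := Matrix.single x x 1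

theorem parseval {κ : Type*} (c : HilbertBasis κ ℂ H) (x : H) :
    ENNReal.ofReal (‖x‖ ^ 2) = ∑' i, ENNReal.ofReal (‖⟪c i, x⟫_ℂ‖ ^ 2) := by
  have h := c.hasSum_inner_mul_inner x x
  have h2 : HasSum (fun i => ‖⟪c i, x⟫_ℂ‖ ^ 2) (‖x‖ ^ 2) := by
    have h3 := Complex.hasSum_re h
    convert h3 using 1
    · funext i
      rw [← inner_conj_symm x (c i), ← Complex.normSq_eq_conj_mul_self, Complex.ofReal_re,
        Complex.normSq_eq_norm_sq]
    · rw [inner_self_eq_norm_sq_to_K]; norm_cast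
  rw [← h2.tsum_eq, ENNReal.ofReal_tsum_of_nonneg (fun _ => by positivity) h2.summable]

end Registers

section TraceNorm

variable {H : Type*} [NormedAddCommGroup H] [InnerProductSpace ℂ H] [CompleteSpace H]

/-- The trace `∑ ⟨e, P e⟩ ∈ [0, ∞]` of a positive operator, over an orthonormal basis. -/
def posTrace (P : H →L[ℂ] H) : ℝ≥0∞ :=
  ∑' e : (exists_hilbertBasis ℂ H).choose,
    ENNReal.ofReal (⟪(e : H), P e⟫_ℂ).re

/-- The trace norm `tr |T|`, where `|T| = √(T† T)`. It is `∞` if `T` is not of trace class. -/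
def traceNorm (T : H →L[ℂ] H) : ℝ≥0∞ := posTrace (CFC.abs T)

/-- The trace of a positive operator may be computed in any orthonormal basis. -/
theorem posTrace_eq {ι : Type*} (b : HilbertBasis ι ℂ H) (P : H →L[ℂ] H) (hP : 0 ≤ P) :
    posTrace P = ∑' i, ENNReal.ofReal (⟪b i, P (b i)⟫_ℂ).re := by
  have hS := CFC.sqrt_nonneg P
  have hSS := CFC.sqrt_mul_sqrt_self P hP
  set S := CFC.sqrt P with hSdef
  have hsym : ∀ x y : H, ⟪S x, y⟫_ℂ = ⟪x, S y⟫_ℂ := by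
    have := (IsSelfAdjoint.of_nonneg hS).isSymmetric
    exact fun x y => this x y
  have key : ∀ x, (⟪x, P x⟫_ℂ).re = ‖S x‖ ^ 2 := by
    intro x
    rw [← hSS, mul_apply_eq_comp, ← hsym, inner_self_eq_norm_sq_to_K]
    norm_cast
  obtain ⟨c, hc⟩ := (exists_hilbertBasis ℂ H).choose_spec
  unfold posTrace
  simp_rw [key]
  rw [tsum_congr fun i : (exists_hilbertBasis ℂ H).choose =>
      parseval b (S (i : H)), tsum_congr fun i => parseval c (S (b i))]
  rw [ENNReal.tsum_comm]
  refine tsum_congr fun i => tsum_congr fun j => ?_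
  rw [hc, ← hsym, ← inner_conj_symm, RCLike.norm_conj]

end TraceNorm

/-! ## Bit strings and qubits -/

/-- Bit strings of length `N`, as vectors over the field with two elements. -/
abbrev Bits (N : ℕ) := Fin N → ZMod 2

/-- The sign `(-1)^a` of a bit `a`. -/
def sgn (a : ZMod 2) : ℂ := (-1) ^ a.val

theorem sgn_add (a b : ZMod 2) : sgn (a + b) = sgn a * sgn b := by
  have h : ∀ a : ZMod 2, a = 0 ∨ a = 1 := by decide
  rcases h a with rfl | rfl <;> rcases h b with rfl | rfl <;>
    simp [sgn, ZMod.val_one, CharTwo.add_self_eq_zero]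

theorem sgn_sum {ι : Type*} (t : Finset ι) (f : ι → ZMod 2) :
    sgn (∑ l ∈ t, f l) = ∏ l ∈ t, sgn (f l) := by
  classical
  induction t using Finset.induction_on with
  | empty => simp [sgn]
  | insert a t ha ih => rw [Finset.sum_insert ha, Finset.prod_insert ha, sgn_add, ih]

theorem sgn_mul_self (a : ZMod 2) : sgn a * sgn a = 1 := by
  rw [← sgn_add, CharTwo.add_self_eq_zero]; simp [sgn]

theorem norm_sgn (a : ZMod 2) : ‖sgn a‖ = 1 := by simp [sgn]

theorem bits_add_add {N : ℕ} (q m : Bits N) : q + m + m = q := by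
  funext l; simp [add_assoc, CharTwo.add_self_eq_zero]

/-- The amplitude `⟨q|i⟩_b`: the basis `b = 0` is the computational basis, the basis `b = 1` is the
Hadamard basis. -/
def qubitAmp (b i q : ZMod 2) : ℂ :=
  if b = 0 then (if q = i then 1 else 0) else ((Real.sqrt 2 : ℝ) : ℂ)⁻¹ * sgn (i * q)

/-- The `N`-qubit state `|i⟩_b = ⊗ⱼ |i_j⟩_{b_j}` in the computational basis. -/
def ket {N : ℕ} (b i : Bits N) : EuclideanSpace ℂ (Bits N) :=
  WithLp.toLp 2 fun q => ∏ l, qubitAmp (b l) (i l) (q l)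

/-! ## Joint attacks and their symmetrization -/

/-- A joint attack with probe space `E`: the initial state `|0⟩_E` of the probe and a unitary on the
`N` qubits together with the probe. -/
structure Attack (N : ℕ) (E : Type*) [NormedAddCommGroup E] [InnerProductSpace ℂ E] where
  zero : E
  norm_zero : ‖zero‖ = 1
  U : Reg (Bits N) E ≃ₗᵢ[ℂ] Reg (Bits N) E

section Attacks

variable {N : ℕ} {E : Type*} [NormedAddCommGroup E] [InnerProductSpace ℂ E]

/-- The unnormalized state `|E'_{i,j}⟩_b = ⟨j|_b U |0⟩_E |i⟩_b` of the probe. -/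
def Attack.probe (A : Attack N E) (b i j : Bits N) : E :=
  ∑ q, conj (ket b j q) • (A.U (prodVec (ket b i) A.zero)) q

/-- The states `|j⟩_b` resolve the identity, so that `U |0⟩_E |i⟩_b = ∑ j, |E'_{i,j}⟩_b |j⟩_b`. -/
theorem Attack.U_ket (A : Attack N E) (b i : Bits N) :
    A.U (prodVec (ket b i) A.zero) = ∑ j, prodVec (ket b j) (A.probe b i j) := by
  have bit : ∀ b q q' : ZMod 2, ∑ j, conj (qubitAmp b j q') * qubitAmp b j q =
      if q' = q then 1 else 0 := by
    have h : ∀ a : ZMod 2, a = 0 ∨ a = 1 := by decide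
    have hs : ((Real.sqrt 2 : ℝ) : ℂ)⁻¹ * ((Real.sqrt 2 : ℝ) : ℂ)⁻¹ = 2⁻¹ := by
      rw [← mul_inv, ← Complex.ofReal_mul, Real.mul_self_sqrt (by norm_num)]; norm_num
    have hu : (Finset.univ : Finset (ZMod 2)) = {0, 1} := by decide
    intro b q q'
    rw [hu, Finset.sum_pair (by decide)]
    rcases h b with rfl | rfl <;> rcases h q with rfl | rfl <;> rcases h q' with rfl | rfl <;>
      simp [qubitAmp, sgn, ZMod.val_one, hs] <;> norm_num
  have key : ∀ q q' : Bits N, ∑ j, conj (ket b j q') * ket b j q = if q' = q then 1 else 0 := by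
    intro q q'
    have h1 : ∀ j : Bits N, conj (ket b j q') * ket b j q =
        ∏ l, conj (qubitAmp (b l) (j l) (q' l)) * qubitAmp (b l) (j l) (q l) := by
      intro j; simp [ket, Finset.prod_mul_distrib, map_prod]
    simp_rw [h1]
    rw [← Fintype.piFinset_univ, ← Finset.prod_univ_sum (fun _ => Finset.univ)
      (fun l a => conj (qubitAmp (b l) a (q' l)) * qubitAmp (b l) a (q l))]
    simp_rw [bit]
    rw [Fintype.prod_ite_zero]
    simp [funext_iff]
  ext q
  simp only [WithLp.ofLp_sum, Finset.sum_apply, prodVec, Attack.probe, Finset.smul_sum, smul_smul]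
  rw [Finset.sum_comm]
  simp_rw [← Finset.sum_smul, mul_comm (ket b _ q), key]
  simp

/-- The probability `Pr(j | i, b, s)` that Bob measures `j` if Alice sends `|i⟩_b`. -/
def Attack.condProb (A : Attack N E) (b i j : Bits N) : ℝ := ‖A.probe b i j‖ ^ 2

/-- Eve's normalized state if Alice sends `|i⟩_b` and Bob measures `j`. -/
def Attack.eveState (A : Attack N E) (b i j : Bits N) : E →L[ℂ] E :=
  ((A.condProb b i j)⁻¹ : ℂ) • InnerProductSpace.rankOne ℂ (A.probe b i j) (A.probe b i j)

/-- Exchange of the qubits and the register `M`. -/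
def swapReg (X Y : Type*) [Fintype X] [Fintype Y] : Reg X (Reg Y E) ≃ₗᵢ[ℂ] Reg Y (Reg X E) where
  toFun Φ := WithLp.toLp 2 fun y => WithLp.toLp 2 fun x => Φ x y
  invFun Φ := WithLp.toLp 2 fun x => WithLp.toLp 2 fun y => Φ y x
  map_add' _ _ := rfl
  map_smul' _ _ := rfl
  left_inv _ := rfl
  right_inv _ := rfl
  norm_map' Φ := by
    rw [← sq_eq_sq₀ (norm_nonneg _) (norm_nonneg _)]
    simp only [PiLp.norm_sq_eq_of_L2, LinearEquiv.coe_mk]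
    exact Finset.sum_comm

/-- `U ⊗ I_M`, acting on the qubits, the probe `E` and the register `M`. -/
def ampl (U : Reg (Bits N) E ≃ₗᵢ[ℂ] Reg (Bits N) E) :
    Reg (Bits N) (Reg (Bits N) E) ≃ₗᵢ[ℂ] Reg (Bits N) (Reg (Bits N) E) :=
  (swapReg (Bits N) (Bits N)).trans
    ((LinearIsometryEquiv.piLpCongrRight 2 fun _ : Bits N => U).trans (swapReg (Bits N) (Bits N)))

/-- The operation `S`, given on the computational basis by
`S |i⟩|m⟩_M = (-1)^{i·m} |i ⊕ m⟩|m⟩_M`. -/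
def symS (N : ℕ) (E : Type*) [NormedAddCommGroup E] [InnerProductSpace ℂ E] :
    Reg (Bits N) (Reg (Bits N) E) ≃ₗᵢ[ℂ] Reg (Bits N) (Reg (Bits N) E) where
  toFun Φ := WithLp.toLp 2 fun q => WithLp.toLp 2 fun m => sgn ((q + m) ⬝ᵥ m) • Φ (q + m) m
  invFun Φ := WithLp.toLp 2 fun q => WithLp.toLp 2 fun m => sgn (q ⬝ᵥ m) • Φ (q + m) m
  map_add' Φ Ψ := by ext q m; simp
  map_smul' c Φ := by ext q m; simp [smul_comm c]
  left_inv Φ := by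
    ext q m
    simp [bits_add_add, smul_smul, sgn_mul_self]
  right_inv Φ := by
    ext q m
    simp [bits_add_add, smul_smul, sgn_mul_self]
  norm_map' Φ := by
    rw [← sq_eq_sq₀ (norm_nonneg _) (norm_nonneg _)]
    simp only [PiLp.norm_sq_eq_of_L2, LinearEquiv.coe_mk, LinearMap.coe_mk, AddHom.coe_mk,
      norm_smul, norm_sgn, one_mul]
    rw [Finset.sum_comm, Finset.sum_comm (s := Finset.univ) (t := Finset.univ)
      (f := fun q m => ‖Φ q m‖ ^ 2)]
    exact Finset.sum_congr rfl fun m _ =>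
      Equiv.sum_comp (Equiv.addRight m) (fun q => ‖Φ q m‖ ^ 2)

/-- In every basis `b`, the operation `S` satisfies
`S |i⟩_b |m⟩_M = (-1)^{(i ⊕ b)·m} |i ⊕ m⟩_b |m⟩_M`. -/
theorem symS_ket (b i m : Bits N) (e : E) :
    symS N E (prodVec (ket b i) (inj m e)) =
      sgn ((i + b) ⬝ᵥ m) • prodVec (ket b (i + m)) (inj m e) := by
  have bit : ∀ b i m q : ZMod 2, sgn ((q + m) * m) * qubitAmp b i (q + m) =
      sgn ((i + b) * m) * qubitAmp b (i + m) q := by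
    have h : ∀ a : ZMod 2, a = 0 ∨ a = 1 := by decide
    intro b i m q
    rcases h b with rfl | rfl <;> rcases h i with rfl | rfl <;> rcases h m with rfl | rfl <;>
      rcases h q with rfl | rfl <;>
      simp [qubitAmp, sgn, ZMod.val_one, CharTwo.add_self_eq_zero]
  ext q m'
  by_cases hm : m' = m
  · subst hm
    have key : sgn ((q + m') ⬝ᵥ m') * ket b i (q + m') =
        sgn ((i + b) ⬝ᵥ m') * ket b (i + m') q := by
      simp only [dotProduct, sgn_sum, ket, ← Finset.prod_mul_distrib]
      exact Finset.prod_congr rfl fun l _ => bit _ _ _ _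
    simp only [prodVec, symS, LinearIsometryEquiv.coe_mk, LinearEquiv.coe_mk, LinearMap.coe_mk,
      AddHom.coe_mk, PiLp.smul_apply, smul_smul]
    rw [key]
  · simp [prodVec, symS, inj, hm]

/-- The initial state `|0⟩_E |0_x⟩_M` of the two probes, where
`|0_x⟩_M = 2^{-N/2} ∑ m, |m⟩_M`. -/
def symZero (N : ℕ) (e : E) : Reg (Bits N) E :=
  WithLp.toLp 2 fun _ => ((Real.sqrt (2 ^ N) : ℝ) : ℂ)⁻¹ • e

/-- The symmetrized attack `U^sym = S† (U ⊗ I_M) S`, whose probe consists of `E` and `M`. -/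
def Attack.sym (A : Attack N E) : Attack N (Reg (Bits N) E) where
  zero := symZero N A.zero
  norm_zero := by
    rw [← sq_eq_sq₀ (norm_nonneg _) zero_le_one]
    simp [symZero, PiLp.norm_sq_eq_of_L2, norm_smul, A.norm_zero, abs_of_nonneg]
  U := (symS N E).trans ((ampl A.U).trans (symS N E).symm)

end Attacks

/-! ## Generalized BB84 protocols -/

/-- The strings `s` of `N` bits with `|s| = n`; the positions with `s_j = 1` are the INFO bits, the
positions with `s_j = 0` are the TEST bits. -/
abbrev InfoString (N n : ℕ) := {s : Bits N // hammingNorm s = n}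

/-- The substring of the INFO bits. -/
def infoPart {N n : ℕ} (s : InfoString N n) (x : Bits N) : Bits n :=
  fun l => x ((Finset.univ.filter fun j => s.1 j ≠ 0).orderEmbOfFin s.2 l)

theorem card_testBits {N n : ℕ} (s : InfoString N n) :
    (Finset.univ.filter fun j => s.1 j = 0).card = N - n := by
  have h := Finset.card_filter_add_card_filter_not (s := (Finset.univ : Finset (Fin N)))
    (fun j => s.1 j = 0)
  have h2 : (Finset.univ.filter fun j => ¬ s.1 j = 0).card = n := s.2
  rw [h2, Finset.card_univ, Fintype.card_fin] at h
  omega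

/-- The substring of the TEST bits. -/
def testPart {N n : ℕ} (s : InfoString N n) (x : Bits N) : Bits (N - n) :=
  fun l => x ((Finset.univ.filter fun j => s.1 j = 0).orderEmbOfFin (card_testBits s) l)

/-- The choices that a protocol makes: the joint distribution of the basis string `b` and of the
string `s`, and the testing function `T(c_T, b_T, s)`. -/
structure Protocol (N n : ℕ) where
  prob : Bits N → InfoString N n → ℝ
  prob_nonneg : ∀ b s, 0 ≤ prob b s
  prob_sum : ∑ b, ∑ s, prob b s = 1
  test : Bits (N - n) → Bits (N - n) → Bits N → Bool

/-- Binary `r × n` matrices. -/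
abbrev BitMatrix (r n : ℕ) := Matrix (Fin r) (Fin n) (ZMod 2)

open Classical in
/-- The pairs `(P_C, P_K)` all of whose `r + m` rows together are linearly independent. -/
def matrixPairs (n r m : ℕ) : Finset (BitMatrix r n × BitMatrix m n) :=
  Finset.univ.filter fun P => LinearIndependent (ZMod 2) (Matrix.fromRows P.1 P.2).row

open Classical in
/-- The uniform distribution on these pairs. -/
def matrixProb {n r m : ℕ} (PC : BitMatrix r n) (PK : BitMatrix m n) : ℝ :=
  if (PC, PK) ∈ matrixPairs n r m then ((matrixPairs n r m).card : ℝ)⁻¹ else 0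

/-- The labels of the basis states `|i_T, j_T, b, s, ξ, P_C, P_K⟩` of the register `C` of published
information. -/
@[ext]
structure Published (N n r m : ℕ) where
  iT : Bits (N - n)
  jT : Bits (N - n)
  b : Bits N
  s : InfoString N n
  xi : Bits r
  PC : BitMatrix r n
  PK : BitMatrix m n

instance (N n r m : ℕ) : DecidableEq (Published N n r m) := Classical.decEq _

instance (N n r m : ℕ) : Fintype (Published N n r m) :=
  Fintype.ofInjective
    (fun c : Published N n r m => ((c.iT, c.jT, c.b), (c.s, c.xi), (c.PC, c.PK)))
    (fun c d h => by
      simp only [Prod.mk.injEq] at h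
      obtain ⟨⟨h1, h2, h3⟩, ⟨h4, h5⟩, h6, h7⟩ := h
      exact Published.ext h1 h2 h3 h4 h5 h6 h7)

section States

variable {N n : ℕ} {E : Type*} [NormedAddCommGroup E] [InnerProductSpace ℂ E]

/-- The probability `Pr(i, j, b, s, P_C, P_K)`, for a uniformly random string `i`. -/
def jointProb {r m : ℕ} (P : Protocol N n) (A : Attack N E) (i j b : Bits N) (s : InfoString N n)
    (PC : BitMatrix r n) (PK : BitMatrix m n) : ℝ :=
  (2 ^ N)⁻¹ * P.prob b s * matrixProb PC PK * A.condProb b i j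

/-- The information published in a run of the protocol, with the syndrome `ξ = i_I P_Cᵀ`. -/
def published {r m : ℕ} (i j b : Bits N) (s : InfoString N n)
    (PC : BitMatrix r n) (PK : BitMatrix m n) : Published N n r m :=
  ⟨testPart s i, testPart s j, b, s, Matrix.vecMul (infoPart s i) PC.transpose, PC, PK⟩

/-- The final key `k = i_I P_Kᵀ`. -/
def finalKey {m : ℕ} (i : Bits N) (s : InfoString N n) (PK : BitMatrix m n) : Bits m :=
  Matrix.vecMul (infoPart s i) PK.transpose

/-- The unnormalized state `σ_ABE`: the sum, over all outcomes that pass the test, of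
`Pr(i, j, b, s, P_C, P_K) |k⟩⟨k|_A ⊗ |k⟩⟨k|_B ⊗ ρ_E ⊗ |i_T, j_T, b, s, ξ, P_C, P_K⟩⟨⋯|_C`,
on the registers `A` and `B`, the register `C` and the probe. -/
def sigmaABE (r m : ℕ) (P : Protocol N n) (A : Attack N E) :
    Reg (Bits m × Bits m) (Reg (Published N n r m) E) →L[ℂ]
      Reg (Bits m × Bits m) (Reg (Published N n r m) E) :=
  ∑ i : Bits N, ∑ j : Bits N, ∑ b : Bits N, ∑ s : InfoString N n,
    ∑ PC : BitMatrix r n, ∑ PK : BitMatrix m n,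
      if P.test (testPart s i + testPart s j) (testPart s b) s.1 = true then
        (jointProb P A i j b s PC PK : ℂ) •
          tensorOp (projector (finalKey i s PK) ⊗ₖ projector (finalKey i s PK))
            (tensorOp (projector (published i j b s PC PK)) (A.eveState b i j))
      else 0

/-- The state `σ_E = tr_AB σ_ABE` of the probe and the register `C`. -/
def sigmaE (r m : ℕ) (P : Protocol N n) (A : Attack N E) :
    Reg (Published N n r m) E →L[ℂ] Reg (Published N n r m) E :=
  traceOut (X := Bits m × Bits m) (H := Reg (Published N n r m) E) (sigmaABE r m P A)

end States

/-- The ideal key `ρ_U = 2^{-m} ∑ k, |k⟩⟨k|_A ⊗ |k⟩⟨k|_B`. -/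
def rhoU (m : ℕ) : Matrix (Bits m × Bits m) (Bits m × Bits m) ℂ :=
  (2 ^ m : ℂ)⁻¹ • ∑ k : Bits m, projector k ⊗ₖ projector k

/-- The distance `½ tr |σ_ABE - ρ_U ⊗ σ_E|`. -/
def keyDistance {N n : ℕ} {E : Type*} [NormedAddCommGroup E] [InnerProductSpace ℂ E]
    [CompleteSpace E] (r m : ℕ) (P : Protocol N n) (A : Attack N E) : ℝ≥0∞ :=
  2⁻¹ * traceNorm (sigmaABE r m P A - tensorOp (rhoU m) (sigmaE r m P A))

end GenBB84

end

universe u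

open scoped ENNReal InnerProductSpace Kronecker ComplexConjugate

noncomputable section

namespace GenBB84

/-! ## The trace norm of self-adjoint operators -/

section SelfAdjoint

variable {H : Type*} [NormedAddCommGroup H] [InnerProductSpace ℂ H] [CompleteSpace H]

/-! The original attack can be recovered from its symmetrization. If the register `M` is found in
the state `|u⟩`, which has squared amplitude `2^{-N}`, the symmetrized attack is the original one
run on `i + u`, `j + u` in place of `i`, `j`, up to signs (`probe_sym`). The string `i` is uniform
and the test depends only on `i + j`, so the weights do not change (`Run.weight_shift`). By
linearity, the shifts of the key and of the syndrome are determined by `u` and the published data,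
so relabelling undoes them (`shiftEmbed`).

No quantum channel is needed. Every operator enters through its quadratic form, an explicit real sum
over runs (`inner_keyDefect`). The maps `shiftEmbed u` are `2^N` isometries with orthogonal ranges,
and the form of the symmetrized defect pulls back along each to `2^{-N}` times the original form
(`inner_keyDefect_sym`). A trace norm dominates the sum of the trace norms of its compressions to
orthogonal subspaces (`card_mul_traceNorm_le`), and `2^N * 2^{-N} = 1`. -/

omit [CompleteSpace H] in
theorem re_inner_nonneg_of_nonneg {P : H →L[ℂ] H} (hP : 0 ≤ P) (x : H) : 0 ≤ (⟪x, P x⟫_ℂ).re :=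
  ((ContinuousLinearMap.nonneg_iff_isPositive P).1 hP).re_inner_nonneg_right x

/-- Split `T = T⁺ - T⁻` and `|T| = T⁺ + T⁻`, with both parts positive. -/
theorem abs_re_inner_le {T : H →L[ℂ] H} (hT : IsSelfAdjoint T) (x : H) :
    |(⟪x, T x⟫_ℂ).re| ≤ (⟪x, CFC.abs T x⟫_ℂ).re := by
  have hp := re_inner_nonneg_of_nonneg (CFC.posPart_nonneg T) x
  have hn := re_inner_nonneg_of_nonneg (CFC.negPart_nonneg T) x
  have h1 : T x = T⁺ x - T⁻ x := DFunLike.congr_fun (CFC.posPart_sub_negPart T hT).symm x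
  have h2 : CFC.abs T x = T⁺ x + T⁻ x := DFunLike.congr_fun (CFC.posPart_add_negPart T hT).symm x
  rw [h1, h2, inner_sub_right, inner_add_right, Complex.sub_re, Complex.add_re, abs_le]
  constructor <;> linarith

/-- The diagonal of a self-adjoint operator is bounded in `ℓ¹` by the trace norm. -/
theorem tsum_abs_re_inner_le_traceNorm {T : H →L[ℂ] H} (hT : IsSelfAdjoint T) {ι : Type*}
    {v : ι → H} (hv : Orthonormal ℂ v) :
    ∑' i, ENNReal.ofReal |(⟪v i, T (v i)⟫_ℂ).re| ≤ traceNorm T := by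
  obtain ⟨w, b, hw, hb⟩ := hv.toSubtypeRange.exists_hilbertBasis_extension
  rw [traceNorm, posTrace_eq b _ (CFC.abs_nonneg T), hb]
  let g : ι → w := fun i => ⟨v i, hw ⟨i, rfl⟩⟩
  have hg : Function.Injective g := fun i j h =>
    hv.linearIndependent.injective (congrArg Subtype.val h)
  calc ∑' i, ENNReal.ofReal |(⟪v i, T (v i)⟫_ℂ).re|
      ≤ ∑' i, ENNReal.ofReal (⟪(g i : H), CFC.abs T (g i : H)⟫_ℂ).re :=
        ENNReal.tsum_le_tsum fun i => ENNReal.ofReal_le_ofReal (abs_re_inner_le hT (v i))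
    _ ≤ _ := ENNReal.tsum_comp_le_tsum_of_injective hg
        (fun e : w => ENNReal.ofReal (⟪(e : H), CFC.abs T (e : H)⟫_ℂ).re)

/-- The diagonal of a self-adjoint operator attains the trace norm in a suitable basis, one that is
adapted to the kernel of the positive part. -/
theorem exists_orthonormal_traceNorm_eq {T : H →L[ℂ] H} (hT : IsSelfAdjoint T) :
    ∃ w : Set H, Orthonormal ℂ ((↑) : w → H) ∧
      traceNorm T = ∑' e : w, ENNReal.ofReal |(⟪(e : H), T e⟫_ℂ).re| := by
  have hp := CFC.posPart_nonneg T
  have hn := CFC.negPart_nonneg T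
  have hps := (IsSelfAdjoint.of_nonneg hp).isSymmetric
  have hns := (IsSelfAdjoint.of_nonneg hn).isSymmetric
  have h1 : ∀ x, T x = T⁺ x - T⁻ x := fun x => DFunLike.congr_fun (CFC.posPart_sub_negPart T hT).symm x
  have h2 : ∀ x, CFC.abs T x = T⁺ x + T⁻ x :=
    fun x => DFunLike.congr_fun (CFC.posPart_add_negPart T hT).symm x
  have hpn : ∀ x, T⁺ (T⁻ x) = 0 := fun x => congr($(CFC.posPart_mul_negPart T) x)
  -- Since `T⁺ T⁻ = 0`, this kernel contains the range of `T⁻`. A basis of `K` extended to one of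
  -- `H` therefore separates the two parts, without any eigenvectors of `T`.
  set K : Submodule ℂ H := LinearMap.ker (T⁺ : H →L[ℂ] H).toLinearMap with hK
  have hKc : IsClosed (K : Set H) := (T⁺ : H →L[ℂ] H).isClosed_ker
  have : CompleteSpace K := hKc.completeSpace_coe
  obtain ⟨u, c, hc⟩ := exists_hilbertBasis ℂ K
  have hcon : Orthonormal ℂ (fun i => (c i : H)) := c.orthonormal.comp_linearIsometry K.subtypeₗᵢ
  obtain ⟨w, b, hw, hb⟩ := hcon.toSubtypeRange.exists_hilbertBasis_extension
  refine ⟨w, hb ▸ b.orthonormal, ?_⟩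
  rw [traceNorm, posTrace_eq b _ (CFC.abs_nonneg T), hb]
  refine tsum_congr fun e => ?_
  congr 1
  by_cases he : (e : H) ∈ Set.range fun i => (c i : H)
  · obtain ⟨i, hi⟩ := he
    have h0 : T⁺ (e : H) = 0 := hi ▸ (c i).2
    rw [h1, h2, h0, zero_add, zero_sub, inner_neg_right, Complex.neg_re, abs_neg,
      abs_of_nonneg (re_inner_nonneg_of_nonneg hn _)]
  -- A basis vector outside the chosen basis of `K` is orthogonal to each of its members, hence to
  -- all of `K` by expansion.
  · have horth : ∀ x ∈ K, ⟪(e : H), x⟫_ℂ = 0 := by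
      intro x hx
      have hbo : Orthonormal ℂ ((↑) : w → H) := hb ▸ b.orthonormal
      have hs := c.hasSum_repr ⟨x, hx⟩
      have hs2 := (innerSL ℂ (e : H)).hasSum (K.subtypeL.hasSum hs)
      refine hs2.unique ?_
      convert hasSum_zero using 2 with i
      have hne : e ≠ ⟨(c i : H), hw ⟨i, rfl⟩⟩ := fun h => he ⟨i, (congrArg Subtype.val h).symm⟩
      have := hbo.2 hne
      simp only at this
      simp [this]
    have h0 : T⁻ (e : H) = 0 := by
      -- `‖T⁻ e‖² = ⟨e, T⁻ T⁻ e⟩`, and `T⁻ T⁻ e` lies in `K`.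
      have h3 : ⟪T⁻ (e : H), T⁻ (e : H)⟫_ℂ = 0 := by
        rw [show ⟪T⁻ (e : H), T⁻ (e : H)⟫_ℂ = ⟪(e : H), T⁻ (T⁻ (e : H))⟫_ℂ from hns _ _]
        exact horth _ (hpn _)
      exact inner_self_eq_zero.1 h3
    rw [h1, h2, h0, add_zero, sub_zero, abs_of_nonneg (re_inner_nonneg_of_nonneg hp _)]

/-- Over `ℂ` a real quadratic form suffices, so self-adjointness can be read off from the formula
for the form. -/
theorem isSelfAdjoint_of_im_inner_eq_zero {T : H →L[ℂ] H} (h : ∀ x, (⟪x, T x⟫_ℂ).im = 0) :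
    IsSelfAdjoint T := by
  rw [ContinuousLinearMap.isSelfAdjoint_iff_isSymmetric,
    LinearMap.isSymmetric_iff_inner_map_self_real]
  intro v
  have h2 := Complex.conj_eq_iff_im.2 (h v)
  rw [inner_conj_symm] at h2 ⊢
  exact h2.symm

/-- If the quadratic form of `T'` restricted to each of finitely many orthogonal copies of `H` is
`a` times that of `T`, then the trace norm of `T'` is at least that of `T`, times `a` and times the
number of copies. -/
theorem card_mul_traceNorm_le {H' : Type*} [NormedAddCommGroup H'] [InnerProductSpace ℂ H']
    [CompleteSpace H'] {T : H →L[ℂ] H} {T' : H' →L[ℂ] H'} (hT : IsSelfAdjoint T)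
    (hT' : IsSelfAdjoint T') {M : Type*} [Fintype M] [DecidableEq M] (V : M → H → H')
    (hV : ∀ m m' x y, ⟪V m x, V m' y⟫_ℂ = if m = m' then ⟪x, y⟫_ℂ else 0) {a : ℝ} (ha : 0 ≤ a)
    (hq : ∀ m x, (⟪V m x, T' (V m x)⟫_ℂ).re = a * (⟪x, T x⟫_ℂ).re) :
    Fintype.card M * ENNReal.ofReal a * traceNorm T ≤ traceNorm T' := by
  classical
  obtain ⟨w, hw, hwT⟩ := exists_orthonormal_traceNorm_eq hT
  -- The family attaining the trace norm of `T` is transported into every copy; the union is a valid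
  -- test family for `T'`.
  have hv : Orthonormal ℂ fun p : M × w => V p.1 p.2 := by
    rw [orthonormal_iff_ite] at hw ⊢
    rintro ⟨m, e⟩ ⟨m', e'⟩
    rw [hV]
    by_cases h : m = m'
    · simp [h, hw e e']
    · simp [h]
  refine le_trans (le_of_eq ?_) (tsum_abs_re_inner_le_traceNorm hT' hv)
  simp_rw [hq, abs_mul, abs_of_nonneg ha, ENNReal.ofReal_mul ha]
  rw [ENNReal.tsum_prod', hwT, mul_assoc]
  simp [ENNReal.tsum_mul_left]

end SelfAdjoint

/-! ## Quadratic forms -/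

section QuadraticForms

variable {X H : Type*} [Fintype X] [DecidableEq X] [NormedAddCommGroup H] [InnerProductSpace ℂ H]

theorem inj_apply (x y : X) (e : H) : inj x e y = if y = x then e else 0 := by
  simp [inj]

theorem inner_inj (x : X) (e : H) (Φ : Reg X H) : ⟪inj x e, Φ⟫_ℂ = ⟪e, Φ x⟫_ℂ := by
  rw [PiLp.inner_apply, Finset.sum_eq_single x]
  · simp [inj_apply]
  · intro y _ hy
    simp [inj_apply, hy]
  · simp

theorem inner_inj_right (x : X) (e : H) (Φ : Reg X H) : ⟪Φ, inj x e⟫_ℂ = ⟪Φ x, e⟫_ℂ := by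
  rw [← inner_conj_symm, inner_inj, inner_conj_symm]

theorem inner_tensorOp (A : Matrix X X ℂ) (T : H →L[ℂ] H) (Φ Ψ : Reg X H) :
    ⟪Φ, tensorOp A T Ψ⟫_ℂ = ∑ x, ∑ y, A x y * ⟪Φ x, T (Ψ y)⟫_ℂ := by
  simp [tensorOp, inner_inj_right]

theorem inner_tensorOp_projector (x : X) (T : H →L[ℂ] H) (Φ Ψ : Reg X H) :
    ⟪Φ, tensorOp (projector x) T Ψ⟫_ℂ = ⟪Φ x, T (Ψ x)⟫_ℂ := by
  rw [inner_tensorOp, Finset.sum_eq_single x, Finset.sum_eq_single x]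
  · simp [projector]
  · intro y _ hy
    simp [projector, hy.symm]
  · simp
  · intro y _ hy
    simp [projector, hy.symm]
  · simp

omit [Fintype X] in
theorem projector_kronecker {Y : Type*} [DecidableEq Y] (x : X) (y : Y) :
    projector x ⊗ₖ projector y = projector (x, y) := by
  simp [projector, Matrix.single_kronecker_single]

theorem inner_traceOut (T : Reg X H →L[ℂ] Reg X H) (e : H) :
    ⟪e, traceOut T e⟫_ℂ = ∑ x, ⟪inj x e, T (inj x e)⟫_ℂ := by
  simp [traceOut, inner_inj]

theorem inner_tensorOp_rhoU {m : ℕ} (T : H →L[ℂ] H) (Φ : Reg (Bits m × Bits m) H) :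
    ⟪Φ, tensorOp (rhoU m) T Φ⟫_ℂ = (2 ^ m)⁻¹ * ∑ k, ⟪Φ (k, k), T (Φ (k, k))⟫_ℂ := by
  have h : ∀ x y, rhoU m x y = (2 ^ m)⁻¹ * ∑ k : Bits m, projector (k, k) x y := fun x y => by
    simp [rhoU, projector_kronecker, Matrix.sum_apply]
  rw [inner_tensorOp, Finset.sum_congr rfl fun k _ =>
    (inner_tensorOp_projector (k, k) T Φ Φ).symm.trans (inner_tensorOp _ T Φ Φ)]
  simp_rw [h, mul_assoc, ← Finset.mul_sum, Finset.sum_mul]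
  congr 1
  rw [Finset.sum_comm (s := (Finset.univ : Finset (Bits m)))]
  exact Finset.sum_congr rfl fun x _ => Finset.sum_comm

end QuadraticForms

/-! ## Runs of the protocol -/

/-- The random choices and outcomes `(i, j, b, s, P_C, P_K)` of a run of the protocol. -/
abbrev Run (N n r m : ℕ) :=
  Bits N × Bits N × Bits N × InfoString N n × BitMatrix r n × BitMatrix m n

namespace Run

variable {N n r m : ℕ} {E : Type*} [NormedAddCommGroup E] [InnerProductSpace ℂ E]

/-- The final key of a run. -/
def key (t : Run N n r m) : Bits m := finalKey t.1 t.2.2.2.1 t.2.2.2.2.2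

/-- The information published in a run. -/
def pub (t : Run N n r m) : Published N n r m :=
  published t.1 t.2.1 t.2.2.1 t.2.2.2.1 t.2.2.2.2.1 t.2.2.2.2.2

/-- The unnormalized state of the probe after a run. -/
def probe (A : Attack N E) (t : Run N n r m) : E := A.probe t.2.2.1 t.1 t.2.1

/-- The probability of the choices made by Alice in a run that passes the test. -/
def weight (P : Protocol N n) (t : Run N n r m) : ℝ :=
  if P.test (testPart t.2.2.2.1 (t.1 + t.2.1)) (testPart t.2.2.2.1 t.2.2.1) t.2.2.2.1.1 = true then
    (2 ^ N)⁻¹ * P.prob t.2.2.1 t.2.2.2.1 * matrixProb t.2.2.2.2.1 t.2.2.2.2.2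
  else 0

/-- The effect on a run of adding `u` both to Alice's and to Bob's string. -/
def shift (u : Bits N) (t : Run N n r m) : Run N n r m := (t.1 + u, t.2.1 + u, t.2.2)

theorem shift_involutive (u : Bits N) : Function.Involutive (shift u : Run N n r m → _) := by
  rintro ⟨i, j, t⟩
  simp [shift, bits_add_add]

/-- The test sees the two strings only through their sum, in which `u` cancels, and the factor `(2 ^
N)⁻¹` is the same for all `i`. -/
theorem weight_shift (P : Protocol N n) (u : Bits N) (t : Run N n r m) :
    weight P (shift u t) = weight P t := by
  have h : t.1 + u + (t.2.1 + u) = t.1 + t.2.1 := by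
    rw [add_add_add_comm, ← add_assoc, bits_add_add]
  simp only [weight, shift, h]

end Run

section Forms

variable {N n r m : ℕ} {E : Type*} [NormedAddCommGroup E] [InnerProductSpace ℂ E]

theorem inner_eveState (A : Attack N E) (b i j : Bits N) (x : E) :
    (A.condProb b i j : ℂ) * ⟪x, A.eveState b i j x⟫_ℂ = (‖⟪A.probe b i j, x⟫_ℂ‖ ^ 2 : ℝ) := by
  -- For an outcome of probability zero the normalized state is a junk value, but both sides vanish.
  by_cases h : A.probe b i j = 0
  · simp [Attack.condProb, h]
  · have h1 : (A.condProb b i j : ℂ) ≠ 0 := by simp [Attack.condProb, h]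
    have h2 : ⟪x, A.eveState b i j x⟫_ℂ = (A.condProb b i j : ℂ)⁻¹ *
        (⟪A.probe b i j, x⟫_ℂ * ⟪x, A.probe b i j⟫_ℂ) := by
      simp [Attack.eveState]
    rw [h2, mul_inv_cancel_left₀ h1, ← inner_conj_symm x, Complex.mul_conj,
      Complex.normSq_eq_norm_sq]

/-- Each run contributes a rank-one operator supported on one basis label of the classical
registers; its probability cancels the normalization of Eve's state. -/
theorem inner_sigmaABE (P : Protocol N n) (A : Attack N E)
    (Φ : Reg (Bits m × Bits m) (Reg (Published N n r m) E)) :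
    ⟪Φ, sigmaABE r m P A Φ⟫_ℂ = (∑ t : Run N n r m,
      t.weight P * ‖⟪t.probe A, Φ (t.key, t.key) t.pub⟫_ℂ‖ ^ 2 : ℝ) := by
  simp only [sigmaABE, Fintype.sum_prod_type, Complex.ofReal_sum, sum_apply,
    inner_sum]
  refine Finset.sum_congr rfl fun i _ => Finset.sum_congr rfl fun j _ =>
    Finset.sum_congr rfl fun b _ => Finset.sum_congr rfl fun s _ =>
    Finset.sum_congr rfl fun PC _ => Finset.sum_congr rfl fun PK _ => ?_
  have ht : testPart s i + testPart s j = testPart s (i + j) := rfl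
  simp only [Run.weight, Run.key, Run.pub, Run.probe, ht]
  split_ifs
  · rw [smul_apply, inner_smul_right, projector_kronecker,
      inner_tensorOp_projector, inner_tensorOp_projector, Complex.ofReal_mul, ← inner_eveState,
      jointProb, Complex.ofReal_mul, mul_assoc]
  · simp

theorem inner_sigmaE (P : Protocol N n) (A : Attack N E) (x : Reg (Published N n r m) E) :
    ⟪x, sigmaE r m P A x⟫_ℂ = (∑ t : Run N n r m,
      t.weight P * ‖⟪t.probe A, x t.pub⟫_ℂ‖ ^ 2 : ℝ) := by
  rw [sigmaE, inner_traceOut]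
  simp_rw [inner_sigmaABE]
  rw [← Complex.ofReal_sum, Finset.sum_comm]
  congr 1
  refine Finset.sum_congr rfl fun t _ => ?_
  -- In the trace over `A` and `B`, only the basis state holding the run's own key contributes.
  rw [Finset.sum_eq_single (t.key, t.key)]
  · simp [inj_apply]
  · intro p _ hp
    simp [inj_apply, hp.symm]
  · simp

/-- The difference between `σ_ABE` and the ideal state `ρ_U ⊗ σ_E`. -/
def keyDefect (r m : ℕ) (P : Protocol N n) (A : Attack N E) :
    Reg (Bits m × Bits m) (Reg (Published N n r m) E) →L[ℂ]
      Reg (Bits m × Bits m) (Reg (Published N n r m) E) :=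
  sigmaABE r m P A - tensorOp (rhoU m) (sigmaE r m P A)

theorem inner_keyDefect (P : Protocol N n) (A : Attack N E)
    (Φ : Reg (Bits m × Bits m) (Reg (Published N n r m) E)) :
    ⟪Φ, keyDefect r m P A Φ⟫_ℂ = (∑ t : Run N n r m, t.weight P *
      (‖⟪t.probe A, Φ (t.key, t.key) t.pub⟫_ℂ‖ ^ 2 -
        (2 ^ m)⁻¹ * ∑ k, ‖⟪t.probe A, Φ (k, k) t.pub⟫_ℂ‖ ^ 2) : ℝ) := by
  rw [keyDefect, sub_apply, inner_sub_right, inner_sigmaABE,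
    inner_tensorOp_rhoU]
  simp_rw [inner_sigmaE, mul_sub, Finset.sum_sub_distrib, mul_left_comm _ (2 ^ m : ℝ)⁻¹,
    ← Finset.mul_sum]
  rw [← Complex.ofReal_sum, Finset.sum_comm]
  push_cast
  simp_rw [Finset.mul_sum]

theorem isSelfAdjoint_keyDefect [CompleteSpace E] (P : Protocol N n) (A : Attack N E) :
    IsSelfAdjoint (keyDefect r m P A) :=
  isSelfAdjoint_of_im_inner_eq_zero fun Φ => by rw [inner_keyDefect, Complex.ofReal_im]

end Forms

/-! ## The symmetrized attack -/

section Symmetrization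

variable {N n r m : ℕ} {E : Type*} [NormedAddCommGroup E] [InnerProductSpace ℂ E]

theorem conj_sgn (a : ZMod 2) : conj (sgn a) = sgn a := by simp [sgn]

theorem sgn_mul_ket (b i u q : Bits N) :
    sgn ((q + u) ⬝ᵥ u) * ket b i (q + u) = sgn ((i + b) ⬝ᵥ u) * ket b (i + u) q := by
  -- The scalar identity is one coordinate of `symS_ket` for the trivial probe `ℂ`.
  have h := congr($(symS_ket (E := ℂ) b i u 1) q u)
  simpa [symS, prodVec, inj_apply] using h

/-- On the slice `|u⟩` of `M`, `S` turns Alice's `i` into `i + u`, `U` acts unchanged, and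
projecting `S†` onto `⟨j|_b` amounts to projecting onto `⟨j + u|_b`. Each of the two operations
leaves one sign. -/
theorem probe_sym (A : Attack N E) (b i j u : Bits N) :
    A.sym.probe b i j u = (((Real.sqrt (2 ^ N) : ℝ) : ℂ)⁻¹ *
      (sgn ((i + b) ⬝ᵥ u) * sgn ((j + b) ⬝ᵥ u))) • A.probe b (i + u) (j + u) := by
  set c := ((Real.sqrt (2 ^ N) : ℝ) : ℂ)⁻¹ with hc
  have h1 : (WithLp.toLp 2 fun q => symS N E (prodVec (ket b i) (symZero N A.zero)) q u) =
      (c * sgn ((i + b) ⬝ᵥ u)) • prodVec (ket b (i + u)) A.zero := by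
    ext q
    simp only [symS, prodVec, symZero, LinearIsometryEquiv.coe_mk, LinearEquiv.coe_mk,
      LinearMap.coe_mk, AddHom.coe_mk, PiLp.smul_apply, smul_smul, ← hc]
    congr 1
    rw [← mul_assoc, sgn_mul_ket]
    ring
  have h2 : ∀ q, (A.sym.U (prodVec (ket b i) A.sym.zero)) q u = sgn (q ⬝ᵥ u) •
      (c * sgn ((i + b) ⬝ᵥ u)) • A.U (prodVec (ket b (i + u)) A.zero) (q + u) := by
    intro q
    -- `U ⊗ I_M` acts on each slice of `M` separately, and `S†` only relabels and multiplies by a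
    -- sign.
    have h3 : (A.sym.U (prodVec (ket b i) A.sym.zero)) q u = sgn (q ⬝ᵥ u) •
      A.U (WithLp.toLp 2 fun q => symS N E (prodVec (ket b i) (symZero N A.zero)) q u) (q + u) :=
      rfl
    rw [h3, h1, map_smul, PiLp.smul_apply]
  simp only [Attack.probe, WithLp.ofLp_sum, Finset.sum_apply, PiLp.smul_apply, h2,
    Finset.smul_sum, smul_smul]
  refine (Equiv.sum_comp (Equiv.addRight u) _).symm.trans (Finset.sum_congr rfl fun q _ => ?_)
  simp only [Equiv.coe_addRight, bits_add_add]
  congr 1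
  have h := congrArg conj (sgn_mul_ket b j u q)
  simp only [map_mul, conj_sgn] at h
  linear_combination (c * sgn ((i + b) ⬝ᵥ u)) * h

theorem norm_inner_probe_sym_inj (A : Attack N E) (b i j u : Bits N) (x : E) :
    ‖⟪A.sym.probe b i j, inj u x⟫_ℂ‖ ^ 2 =
      (2 ^ N)⁻¹ * ‖⟪A.probe b (i + u) (j + u), x⟫_ℂ‖ ^ 2 := by
  rw [inner_inj_right, probe_sym, inner_smul_left]
  simp [norm_sgn, mul_pow, abs_of_nonneg]

/-- The shift of the published information that results from adding `u` both to Alice's and to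
Bob's string. -/
def Published.shift (u : Bits N) (c : Published N n r m) : Published N n r m :=
  { c with
    iT := c.iT + testPart c.s u
    jT := c.jT + testPart c.s u
    xi := c.xi + Matrix.vecMul (infoPart c.s u) c.PC.transpose }

/-- The shift of the final key that results from adding `u` both to Alice's and to Bob's string. -/
def Published.keyShift (u : Bits N) (c : Published N n r m) : Bits m := finalKey u c.s c.PK

theorem Published.shift_involutive (u : Bits N) :
    Function.Involutive (Published.shift u : Published N n r m → _) := by
  intro c
  ext1 <;> simp [Published.shift, bits_add_add]

theorem Run.pub_shift (u : Bits N) (t : Run N n r m) : (t.shift u).pub = t.pub.shift u := by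
  have h : infoPart t.2.2.2.1 (t.1 + u) = infoPart t.2.2.2.1 t.1 + infoPart t.2.2.2.1 u := rfl
  simp only [Run.pub, Run.shift, published, Published.shift, h, Matrix.add_vecMul]
  rfl

/-- The key is linear in `i`, and its shift involves only `u`, `s` and `P_K`; the last two are
published, so the shift is a function of the content of the register `C`. -/
theorem Run.key_shift (u : Bits N) (t : Run N n r m) :
    (t.shift u).key = t.key + t.pub.keyShift u := by
  have h : infoPart t.2.2.2.1 (t.1 + u) = infoPart t.2.2.2.1 t.1 + infoPart t.2.2.2.1 u := rfl
  simp only [Run.key, Run.shift, finalKey, h, Matrix.add_vecMul]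
  rfl

/-- The embedding of the state space of the original attack into that of the symmetrized attack
which puts the register `M` into the state `|u⟩` and shifts the key and the published information
accordingly. -/
def shiftEmbed (u : Bits N) (Φ : Reg (Bits m × Bits m) (Reg (Published N n r m) E)) :
    Reg (Bits m × Bits m) (Reg (Published N n r m) (Reg (Bits N) E)) :=
  WithLp.toLp 2 fun k => WithLp.toLp 2 fun c =>
    inj u (Φ (k.1 + c.keyShift u, k.2 + c.keyShift u) (c.shift u))

/-- Different `u` give orthogonal states of `M`; for equal `u` the map only permutes the labels of
the classical registers. -/
theorem inner_shiftEmbed (u u' : Bits N)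
    (Φ Ψ : Reg (Bits m × Bits m) (Reg (Published N n r m) E)) :
    ⟪shiftEmbed u Φ, shiftEmbed u' Ψ⟫_ℂ = if u = u' then ⟪Φ, Ψ⟫_ℂ else 0 := by
  simp only [PiLp.inner_apply (𝕜 := ℂ) (x := shiftEmbed u Φ), PiLp.inner_apply (𝕜 := ℂ) (x := Φ)]
  simp only [PiLp.inner_apply (f := fun _ : Published N n r m => _), shiftEmbed]
  simp only [inner_inj, inj_apply]
  split_ifs with h
  · subst h
    -- The sum over `c` goes outside because the translation of the keys depends on `c`.
    rw [Finset.sum_comm, Finset.sum_comm (s := (Finset.univ : Finset (Bits m × Bits m)))]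
    conv_rhs => rw [← Equiv.sum_comp (Published.shift_involutive u).toPerm]
    refine Finset.sum_congr rfl fun c _ => ?_
    exact Equiv.sum_comp
      ((Equiv.addRight (c.keyShift u)).prodCongr (Equiv.addRight (c.keyShift u)))
      fun k => ⟪Φ k (c.shift u), Ψ k (c.shift u)⟫_ℂ
  · simp

/-- Shifting the summation over runs by `u` matches the two forms term by term; the factor is the
squared amplitude of `|u⟩` in the initial state of `M`. -/
theorem inner_keyDefect_sym (P : Protocol N n) (A : Attack N E) (u : Bits N)
    (Φ : Reg (Bits m × Bits m) (Reg (Published N n r m) E)) :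
    (⟪shiftEmbed u Φ, keyDefect r m P A.sym (shiftEmbed u Φ)⟫_ℂ).re =
      (2 ^ N)⁻¹ * (⟪Φ, keyDefect r m P A Φ⟫_ℂ).re := by
  have h : ∀ (t : Run N n r m) (k : Bits m),
      ‖⟪t.probe A.sym, shiftEmbed u Φ (k, k) t.pub⟫_ℂ‖ ^ 2 = (2 ^ N)⁻¹ *
        ‖⟪(t.shift u).probe A, Φ (k + t.pub.keyShift u, k + t.pub.keyShift u)
          (t.shift u).pub⟫_ℂ‖ ^ 2 := by
    intro t k
    rw [Run.pub_shift]
    exact norm_inner_probe_sym_inj _ _ _ _ _ _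
  rw [inner_keyDefect, inner_keyDefect, Complex.ofReal_re, Complex.ofReal_re, Finset.mul_sum,
    ← Equiv.sum_comp (Run.shift_involutive u).toPerm (fun t => (2 ^ N : ℝ)⁻¹ * _)]
  refine Finset.sum_congr rfl fun t _ => ?_
  -- The ideal term averages over all keys, so translating the key leaves it unchanged.
  have h2 := Equiv.sum_comp (Equiv.addRight (t.pub.keyShift u)) fun k =>
    ‖⟪(t.shift u).probe A, Φ (k, k) (t.shift u).pub⟫_ℂ‖ ^ 2
  simp only [Equiv.coe_addRight] at h2
  simp only [Function.Involutive.coe_toPerm, h, Run.weight_shift, Run.key_shift, ← Finset.mul_sum,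
    h2]
  ring

theorem keyDistance_le_sym [CompleteSpace E] (r m : ℕ) (P : Protocol N n) (A : Attack N E) :
    keyDistance r m P A ≤ keyDistance r m P A.sym := by
  have h := card_mul_traceNorm_le (isSelfAdjoint_keyDefect (r := r) (m := m) P A)
    (isSelfAdjoint_keyDefect P A.sym) shiftEmbed inner_shiftEmbed (a := (2 ^ N)⁻¹) (by positivity)
    (inner_keyDefect_sym P A)
  have h1 : (Fintype.card (Bits N) : ℝ≥0∞) * ENNReal.ofReal (2 ^ N)⁻¹ = 1 := by
    rw [ENNReal.ofReal_inv_of_pos (by positivity), ENNReal.ofReal_pow (by positivity)]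
    simp [ZMod.card, ENNReal.mul_inv_cancel]
  rw [h1, one_mul] at h
  exact mul_le_mul_right h _

end Symmetrization

end GenBB84

end

theorem mainTheorem6 {N n r m : ℕ} (hrm : r + m ≤ n) (hnN : n < N) (P : GenBB84.Protocol N n) :
    (∀ (E : Type u) [NormedAddCommGroup E] [InnerProductSpace ℂ E] [CompleteSpace E]
      (A : GenBB84.Attack N E),
      GenBB84.keyDistance r m P A ≤ GenBB84.keyDistance r m P A.sym) ∧
    (∀ ε : ℝ≥0∞,
      (∀ (E : Type u) [NormedAddCommGroup E] [InnerProductSpace ℂ E] [CompleteSpace E]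
        (A : GenBB84.Attack N E), GenBB84.keyDistance r m P A.sym ≤ ε) →
      ∀ (E : Type u) [NormedAddCommGroup E] [InnerProductSpace ℂ E] [CompleteSpace E]
        (A : GenBB84.Attack N E), GenBB84.keyDistance r m P A ≤ ε) := by
  have h : ∀ (E : Type u) [NormedAddCommGroup E] [InnerProductSpace ℂ E] [CompleteSpace E]
      (A : GenBB84.Attack N E), GenBB84.keyDistance r m P A ≤ GenBB84.keyDistance r m P A.sym :=
    fun E _ _ _ A => GenBB84.keyDistance_le_sym r m P A
  exact ⟨h, fun ε hε E _ _ _ A => (h E A).trans (hε E A)⟩
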